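/- Let $\mu:[-1,1]\to\mathbb{R}$ be continuous, strictly increasing, twice differentiable except possibly at $0$, with $\mu(0)=0$. Suppose that $\mu$ is symmetric around $0$, i.e. $\mu(-x)=-\mu(x)$ for all $x\in[0,1]$, and that $\mu''(x)<0$ for all $x\in(0,1)$. Let $M$ be a nonempty finite set of messages, $T\ge 2$ an integer, and $\pi_0\in[0,1]$. Consider the following cheap-talk game with state $\theta\in\{G,B\}$, where $\pi_0$ is the prior probability of $G$. The sender observes $\theta$ and in each period $t=1,\dots,T-1$ publicly sends a message in $M$; her strategy specifies for each $t$ a distribution $\sigma_t(\cdot\mid h^{t-1},\theta)$ on $M$ depending on the history $h^{t-1}\in H^{t-1}:=M^{t-1}$ of messages sent so far and on $\theta$. The receiver holds the belief $p(h^t)\in[0,1]$ that $\theta=G$ after each $h^t\in H^t$, $0\le t\le T-1$. In period $T$ he learns the state, whatever the history, so that $\pi_T=1$ if $\theta=G$ and $\pi_T=0$ if $\theta=B$. With $\pi_t:=p(h^t)$ for $0\le t\le T-1$, both players' total payoff is $\sum_{t=1}^{T}\mu(\pi_t-\pi_{t-1})$. An equilibrium is a perfect-Bayesian equilibrium $(\sigma,p)$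 satisfying two belief refinements, namely a pair such that 1. for every $1\le t\le T-1$, every $h^{t-1}\in H^{t-1}$ and every $\theta\in\{G,B\}$, given $p$, the strategy $\sigma$ maximizes, among all strategies, the expected value of $\sum_{s=t}^{T}\mu(\pi_s-\pi_{s-1})$ conditional on $h^{t-1}$ and $\theta$; 2. $p$ is derived from $\pi_0$ and $\sigma$ by Bayes' rule whenever possible; 3. if $t\le T-1$, $h^t$ is a continuation of $h^{s}$, and $p(h^{s})\in\{0,1\}$, then $p(h^t)=p(h^{s})$; 4. the belief in period $T$ is the degenerate belief on the true state after every history (as already specified above). Let $\mathcal V_{\mu,M,T}(\pi_0)\subseteq\mathbb{R}$ be the set of ex-ante expected payoffs of all equilibria. Then $$\mathcal V_{\mu,M,T}(\pi_0)=\{\pi_0\,\mu(1-\pi_0)+(1-\pi_0)\,\mu(-\pi_0)\},$$ that is, the babbling payoff is the only equilibrium payoff. This holds both when "whenever possible" in 2 is read as applying only to histories that have positive probability under $\sigma$ and $\pi_0$, and when it is read as applying in every period after every history $h^{t-1}$, on or off the path of play, to update the belief $p(h^{t-1})$ by the strategy $\sigma_t(\cdot\mid h^{t-1},\cdot)$ after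 each message to which these give positive probability (with $p(h^0)=\pi_0$). -/

import Mathlib

namespace NewsUtility

/-- The binary state space. -/
inductive State
  | good
  | bad

/-- The expected consumption utility of the degenerate belief on a state, that is, the
probability which that belief gives to the good state. -/
def State.indicator : State → ℝ
  | .good => 1
  | .bad => 0

/-- The standing assumptions on a gain-loss utility function `μ : [-1, 1] → ℝ`. It is represented
by a function on `ℝ`, of which only the restriction to `[-1, 1]` is ever used. Nothing is asked
about one-sided derivatives at the end points `-1` and `1`. -/
structure IsGainLoss (μ : ℝ → ℝ) : Prop where
  continuousOn : ContinuousOn μ (Set.Icc (-1) 1)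
  strictMonoOn : StrictMonoOn μ (Set.Icc (-1) 1)
  differentiableAt : ∀ x ∈ Set.Ioo (-1 : ℝ) 1, x ≠ 0 → DifferentiableAt ℝ μ x
  differentiableAt_deriv : ∀ x ∈ Set.Ioo (-1 : ℝ) 1, x ≠ 0 → DifferentiableAt ℝ (deriv μ) x
  map_zero : μ 0 = 0

/-- `μ` is symmetric around `0`: losses count exactly as much as gains of the same size. -/
def SymmetricAroundZero (μ : ℝ → ℝ) : Prop :=
  ∀ x ∈ Set.Icc (0 : ℝ) 1, μ (-x) = -μ x

/-- Strict concavity on gains, in the form `μ'' < 0`. -/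
def StrictlyConcaveOnGains (μ : ℝ → ℝ) : Prop :=
  ∀ x ∈ Set.Ioo (0 : ℝ) 1, deriv (deriv μ) x < 0

section Game

variable {M : Type*}

/-- A candidate sender strategy: `σ h θ m` is the probability of sending message `m` next when
the public history of messages is `h` and the state is `θ`. A public history is the list of the
messages sent so far, the most recent one first, so `m :: h` is `h` followed by `m`. Values at
histories that are longer than the game never matter. -/
abbrev Strategy (M : Type*) := List M → State → M → ℝ

/-- A candidate belief system: `p h` is the receiver's probability of the good state after the
public history `h`. -/
abbrev Beliefs (M : Type*) := List M → ℝ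

/-- The sender's strategy prescribes a probability distribution over messages everywhere. -/
def IsStrategy [Fintype M] (σ : Strategy M) : Prop :=
  ∀ h θ, σ h θ ∈ stdSimplex ℝ M

/-- The receiver's total expected news utility in all remaining periods, conditional on the
public history `h` and the state `θ`, when `n` periods of communication remain, the sender plays
`σ`, and the receiver's beliefs are given by `p`. In the final period, after the communication,
the receiver learns the state, whatever the history. -/
def expectedNewsUtility [Fintype M] (μ : ℝ → ℝ) (p : Beliefs M) (σ : Strategy M) (θ : State) :
    ℕ → List M → ℝ
  | 0, h => μ (θ.indicator - p h)
  | n + 1, h =>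
      ∑ m, σ h θ m * (μ (p (m :: h) - p h) + expectedNewsUtility μ p σ θ n (m :: h))

/-- The probability of the public history `h` in state `θ` when the sender plays `σ`. -/
def reachProb (σ : Strategy M) (θ : State) : List M → ℝ
  | [] => 1
  | m :: h => reachProb σ θ h * σ h θ m

/-- Two ways of reading "beliefs are derived by Bayes' rule whenever possible". -/
inductive BayesScope
  /-- Bayes' rule is required only at histories on the path of play. -/
  | onPath
  /-- Bayes' rule is required in every period after every history, also after those off the path
  of play, starting from the belief held at that history. -/
  | everyHistory

/-- The beliefs `p` are derived by Bayes' rule from the strategy `σ` and the prior `π₀` whenever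
possible, in the game with horizon `T`. -/
def BayesConsistent (T : ℕ) (π₀ : ℝ) (σ : Strategy M) (p : Beliefs M) : BayesScope → Prop
  | .onPath =>
      ∀ h : List M, h.length < T →
        0 < π₀ * reachProb σ .good h + (1 - π₀) * reachProb σ .bad h →
        p h = π₀ * reachProb σ .good h /
          (π₀ * reachProb σ .good h + (1 - π₀) * reachProb σ .bad h)
  | .everyHistory =>
      p [] = π₀ ∧
      ∀ (h : List M) (m : M), h.length + 1 < T →
        0 < p h * σ h .good m + (1 - p h) * σ h .bad m →
        p (m :: h) = p h * σ h .good m / (p h * σ h .good m + (1 - p h) * σ h .bad m)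

/-- `(σ, p)` is a perfect-Bayesian equilibrium of the cheap-talk game with periods `0, …, T`, with
messages in the periods `1, …, T - 1`, satisfying the belief refinements. -/
structure IsEquilibrium [Fintype M] (s : BayesScope) (μ : ℝ → ℝ) (T : ℕ) (π₀ : ℝ)
    (σ : Strategy M) (p : Beliefs M) : Prop where
  isStrategy : IsStrategy σ
  belief_mem : ∀ h, p h ∈ Set.Icc (0 : ℝ) 1
  /-- At the start of each communication period, after every public history and in each state,
  `σ` is optimal among all strategies, given the beliefs `p`. -/
  optimal : ∀ (h : List M) (θ : State), h.length + 1 < T → ∀ τ : Strategy M, IsStrategy τ →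
    expectedNewsUtility μ p τ θ (T - 1 - h.length) h ≤
      expectedNewsUtility μ p σ θ (T - 1 - h.length) h
  bayes : BayesConsistent T π₀ σ p s
  /-- A belief of `0` or `1` never changes before the final period. (`g <:+ h` says that the
  history `h` is a continuation of the history `g`.) -/
  degenerate : ∀ g h : List M, g <:+ h → h.length < T → (p g = 0 ∨ p g = 1) → p h = p g

/-- The set of ex-ante equilibrium payoffs. -/
def equilibriumPayoffs (s : BayesScope) (μ : ℝ → ℝ) (M : Type*) [Fintype M] (T : ℕ) (π₀ : ℝ) :
    Set ℝ :=
  {v | ∃ (σ : Strategy M) (p : Beliefs M), IsEquilibrium s μ T π₀ σ p ∧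
    v = π₀ * expectedNewsUtility μ p σ .good (T - 1) [] +
      (1 - π₀) * expectedNewsUtility μ p σ .bad (T - 1) []}

/-- The payoff of the babbling equilibrium. -/
def babblingPayoff (μ : ℝ → ℝ) (π₀ : ℝ) : ℝ :=
  π₀ * μ (1 - π₀) + (1 - π₀) * μ (-π₀)

end Game

end NewsUtility

/-!
Strict concavity of `μ` on `[0, 1]` together with `μ 0 = 0` gives strict subadditivity there
(`IsGainLoss.map_add_lt`), and everything rests on the incentives of the sender in the bad state.
Suppose she holds the belief `π ∈ (0, 1)`, and that moving it to `x` in the coming period is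
followed by a continuation worth `μ (-x) = -μ x`. Then such a move is worth `μ (x - π) - μ x`.
By subadditivity and symmetry this is at most `-μ π` for `x ≤ π` and exceeds `-μ π` for `x > π`.
So as soon as some message raises the belief, the bad sender refuses every message that lowers it.
But a message lowers the belief exactly when the bad sender uses it more than the good one does,
and since both use the messages with total probability `1`, a message that raises the belief
exists if and only if one that lowers it does. Hence both types use every message with the same
probability, and the belief does not move.

Backward induction turns this into a proof that the remaining utility in state `θ` is
`μ (θ - p h)` (`IsEquilibrium.expectedNewsUtility_eq`). The induction runs over the histories `h`
that have positive probability in both states or carry a degenerate belief. This class suffices,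
because every message sent with positive probability in some state leads from one such history
to another. No condition on beliefs at other off-path histories enters, so the argument needs
Bayes' rule only on the path of play, and that version is implied by the version for every
history (`BayesConsistent.onPath`). Conversely, constant beliefs with uniform messages form an
equilibrium under the stronger version (`isEquilibrium_babbling`).
-/

namespace NewsUtility

open Finset

variable {M : Type*}

/-! ### Subadditivity of gain utility -/

theorem IsGainLoss.map_add_lt {μ : ℝ → ℝ} (hμ : IsGainLoss μ) (hconc : StrictlyConcaveOnGains μ)
    {a b : ℝ} (ha : 0 < a) (hb : 0 < b) (hab : a + b ≤ 1) : μ (a + b) < μ a + μ b := by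
  have hsc : StrictConcaveOn ℝ (Set.Icc (0 : ℝ) 1) μ := by
    refine strictConcaveOn_of_deriv2_neg (convex_Icc 0 1)
      (hμ.continuousOn.mono (Set.Icc_subset_Icc (by norm_num) le_rfl)) fun x hx => ?_
    rw [interior_Icc] at hx
    simpa using hconc x hx
  have hs : 0 < a + b := by positivity
  have h0 : (0 : ℝ) ∈ Set.Icc (0 : ℝ) 1 := by simp
  have h1 : a + b ∈ Set.Icc (0 : ℝ) 1 := ⟨hs.le, hab⟩
  have hsum : b / (a + b) + a / (a + b) = 1 := by field_simp; ring
  -- `a` and `b` are the convex combinations of `0` and `a + b` with exchanged weights.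
  have h2 := hsc.2 h0 h1 hs.ne (div_pos hb hs) (div_pos ha hs) hsum
  have h3 := hsc.2 h0 h1 hs.ne (div_pos ha hs) (div_pos hb hs) (by rw [add_comm]; exact hsum)
  simp only [smul_eq_mul, hμ.map_zero, mul_zero, zero_add, div_mul_cancel₀ _ hs.ne'] at h2 h3
  have h4 : a / (a + b) * μ (a + b) + b / (a + b) * μ (a + b) = μ (a + b) := by
    rw [← add_mul, add_comm (a / _), hsum, one_mul]
  linarith

/-- In the bad state, lowering the belief from `q` to `x` and learning the state next is no better
than learning the state at once. -/
theorem IsGainLoss.loss_le {μ : ℝ → ℝ} (hμ : IsGainLoss μ) (hsymm : SymmetricAroundZero μ)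
    (hconc : StrictlyConcaveOnGains μ) {q x : ℝ} (hx : 0 ≤ x) (hxq : x < q) (hq : q ≤ 1) :
    μ (x - q) + μ (0 - x) ≤ μ (0 - q) := by
  have e1 : μ (x - q) = -μ (q - x) := by
    rw [← hsymm (q - x) ⟨by linarith, by linarith⟩, neg_sub]
  have e2 : μ (0 - x) = -μ x := by rw [zero_sub, hsymm x ⟨hx, by linarith⟩]
  have e3 : μ (0 - q) = -μ q := by rw [zero_sub, hsymm q ⟨by linarith, hq⟩]
  rcases hx.eq_or_lt with rfl | hx
  · simp [hμ.map_zero]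
  · have h := hμ.map_add_lt hconc (sub_pos.2 hxq) hx (by linarith)
    rw [sub_add_cancel] at h
    linarith

/-- In the bad state, raising the belief from `q` to `x` and learning the state next is better
than learning the state at once. -/
theorem IsGainLoss.lt_false_hope {μ : ℝ → ℝ} (hμ : IsGainLoss μ) (hsymm : SymmetricAroundZero μ)
    (hconc : StrictlyConcaveOnGains μ) {q x : ℝ} (hq : 0 < q) (hqx : q < x) (hx : x ≤ 1) :
    μ (0 - q) < μ (x - q) + μ (0 - x) := by
  have e2 : μ (0 - x) = -μ x := by rw [zero_sub, hsymm x ⟨by linarith, hx⟩]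
  have e3 : μ (0 - q) = -μ q := by rw [zero_sub, hsymm q ⟨hq.le, by linarith⟩]
  have h := hμ.map_add_lt hconc (sub_pos.2 hqx) hq (by linarith)
  rw [sub_add_cancel] at h
  linarith

/-! ### Bayes' rule -/

theorem IsStrategy.reachProb_nonneg [Fintype M] {σ : Strategy M} (hσ : IsStrategy σ) (θ : State)
    (h : List M) : 0 ≤ reachProb σ θ h := by
  induction h with
  | nil => simp [reachProb]
  | cons m h ih => exact mul_nonneg ih ((hσ h θ).1 m)

/-- Updating in two steps is updating at once: the belief `A / (A + B)` updated by the likelihoods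
`g` and `b` is the belief from the joint weights `A * g` and `B * b`. -/
theorem div_mul_div_eq_bayes {A B g b : ℝ} (hAB : A + B ≠ 0) :
    A / (A + B) * g / (A / (A + B) * g + (1 - A / (A + B)) * b) = A * g / (A * g + B * b) := by
  have e1 : A / (A + B) * g = A * g / (A + B) := by ring
  have e2 : A / (A + B) * g + (1 - A / (A + B)) * b = (A * g + B * b) / (A + B) := by
    field_simp; ring
  rw [e2, e1, div_div_div_cancel_right₀ hAB]

theorem BayesConsistent.onPath [Fintype M] {T : ℕ} {π₀ : ℝ} {σ : Strategy M} {p : Beliefs M}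
    {s : BayesScope} (hσ : IsStrategy σ) (hπ₀ : π₀ ∈ Set.Icc (0 : ℝ) 1)
    (hB : BayesConsistent T π₀ σ p s) : BayesConsistent T π₀ σ p .onPath := by
  cases s with
  | onPath => exact hB
  | everyHistory =>
    obtain ⟨h0, hstep⟩ := hB
    intro h
    induction h with
    | nil => intro _ _; simp [reachProb, h0]
    | cons m h ih =>
      intro hlen hpos
      simp only [List.length_cons] at hlen
      have hG := mul_nonneg hπ₀.1 (hσ.reachProb_nonneg .good h)
      have hBd := mul_nonneg (sub_nonneg.2 hπ₀.2) (hσ.reachProb_nonneg .bad h)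
      have hD : 0 < π₀ * reachProb σ .good h + (1 - π₀) * reachProb σ .bad h := by
        refine (add_nonneg hG hBd).lt_of_ne' fun h0 => hpos.ne' ?_
        have z1 : π₀ * reachProb σ .good h = 0 := by linarith
        have z2 : (1 - π₀) * reachProb σ .bad h = 0 := by linarith
        simp only [reachProb, ← mul_assoc, z1, z2]
        simp
      simp only [reachProb, ← mul_assoc] at hpos ⊢
      have hp := ih (by omega) hD
      have hw : p h * σ h .good m + (1 - p h) * σ h .bad m =
          (π₀ * reachProb σ .good h * σ h .good m + (1 - π₀) * reachProb σ .bad h * σ h .bad m) /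
            (π₀ * reachProb σ .good h + (1 - π₀) * reachProb σ .bad h) := by
        rw [hp]; field_simp; ring
      rw [hstep h m hlen (by rw [hw]; exact div_pos hpos hD), hp, div_mul_div_eq_bayes hD.ne']

/-! ### One-shot deviations -/

theorem expectedNewsUtility_congr [Fintype M] {μ : ℝ → ℝ} {p : Beliefs M} {σ τ : Strategy M}
    {θ : State} (n : ℕ) (h : List M) (hστ : ∀ g, h <:+ g → σ g = τ g) :
    expectedNewsUtility μ p σ θ n h = expectedNewsUtility μ p τ θ n h := by
  induction n generalizing h with
  | zero => rfl
  | succ n ih =>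
    simp only [expectedNewsUtility]
    refine sum_congr rfl fun m _ => ?_
    rw [hστ h List.suffix_rfl, ih (m :: h) fun g hg => hστ g ((List.suffix_cons m h).trans hg)]

/-- In equilibrium no single message, followed by the equilibrium strategy, is better than
equilibrium play. -/
theorem IsEquilibrium.message_le [Fintype M] {s : BayesScope} {μ : ℝ → ℝ} {T : ℕ} {π₀ : ℝ}
    {σ : Strategy M} {p : Beliefs M} (he : IsEquilibrium s μ T π₀ σ p) {n : ℕ} {h : List M}
    (hn : n + 1 + h.length + 1 = T) (θ : State) (m : M) :
    μ (p (m :: h) - p h) + expectedNewsUtility μ p σ θ n (m :: h) ≤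
      expectedNewsUtility μ p σ θ (n + 1) h := by
  classical
  let τ : Strategy M := fun g ϑ => if g = h then Pi.single m 1 else σ g ϑ
  have hτ : IsStrategy τ := fun g ϑ => by
    by_cases hg : g = h
    · simpa [τ, hg] using single_mem_stdSimplex ℝ m
    · simpa [τ, hg] using he.isStrategy g ϑ
  have hopt := he.optimal h θ (by omega) τ hτ
  rw [show T - 1 - h.length = n + 1 by omega] at hopt
  have hcong : expectedNewsUtility μ p τ θ n (m :: h) = expectedNewsUtility μ p σ θ n (m :: h) := by
    refine expectedNewsUtility_congr n _ fun g hg => ?_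
    have hgh : g ≠ h := by
      rintro rfl
      simpa using hg.length_le
    funext ϑ
    simp [τ, hgh]
  have hval : expectedNewsUtility μ p τ θ (n + 1) h =
      μ (p (m :: h) - p h) + expectedNewsUtility μ p τ θ n (m :: h) := by
    rw [expectedNewsUtility, sum_eq_single m]
    · simp [τ]
    · intro b _ hb
      simp [τ, hb]
    · simp
  rw [hval, hcong] at hopt
  exact hopt

/-- A message that is sent with positive probability is optimal. -/
theorem IsEquilibrium.message_eq [Fintype M] {s : BayesScope} {μ : ℝ → ℝ} {T : ℕ} {π₀ : ℝ}
    {σ : Strategy M} {p : Beliefs M} (he : IsEquilibrium s μ T π₀ σ p) {n : ℕ} {h : List M}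
    (hn : n + 1 + h.length + 1 = T) (θ : State) {m : M} (hm : 0 < σ h θ m) :
    μ (p (m :: h) - p h) + expectedNewsUtility μ p σ θ n (m :: h) =
      expectedNewsUtility μ p σ θ (n + 1) h := by
  refine (he.message_le hn θ m).eq_of_not_lt fun hlt => ?_
  obtain ⟨hnn, hsum⟩ := he.isStrategy h θ
  have key : expectedNewsUtility μ p σ θ (n + 1) h <
      ∑ m', σ h θ m' * expectedNewsUtility μ p σ θ (n + 1) h := by
    conv_lhs => rw [expectedNewsUtility]
    exact sum_lt_sum (fun m' _ => mul_le_mul_of_nonneg_left (he.message_le hn θ m') (hnn m'))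
      ⟨m, mem_univ m, mul_lt_mul_of_pos_left hlt hm⟩
  rw [← sum_mul, hsum, one_mul] at key
  exact key.false

/-! ### Equilibrium beliefs do not move -/

/-- At a history with positive probability in both states, and with a prior in `(0, 1)`, the
belief is in `(0, 1)` and is updated by Bayes' rule after each message sent in some state. -/
theorem BayesConsistent.update [Fintype M] {T : ℕ} {π₀ : ℝ} {σ : Strategy M} {p : Beliefs M}
    (hB : BayesConsistent T π₀ σ p .onPath) (hσ : IsStrategy σ) (hπ₀ : π₀ ∈ Set.Ioo (0 : ℝ) 1)
    {h : List M} (hG : 0 < reachProb σ .good h) (hBd : 0 < reachProb σ .bad h)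
    (hlen : h.length + 1 < T) :
    p h ∈ Set.Ioo (0 : ℝ) 1 ∧ ∀ m, 0 < σ h .good m ∨ 0 < σ h .bad m →
      p (m :: h) = p h * σ h .good m / (p h * σ h .good m + (1 - p h) * σ h .bad m) := by
  have hA : 0 < π₀ * reachProb σ .good h := mul_pos hπ₀.1 hG
  have hC : 0 < (1 - π₀) * reachProb σ .bad h := mul_pos (sub_pos.2 hπ₀.2) hBd
  have hp := hB h (by omega) (by positivity)
  refine ⟨?_, fun m hm => ?_⟩
  · rw [hp]
    exact ⟨by positivity, (div_lt_one (by positivity)).2 (by linarith)⟩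
  · have g0 := (hσ h .good).1 m
    have b0 := (hσ h .bad).1 m
    have hpos : 0 < π₀ * reachProb σ .good h * σ h .good m +
        (1 - π₀) * reachProb σ .bad h * σ h .bad m := by
      rcases hm with hm | hm <;> positivity
    have hpm := hB (m :: h) (by simpa using hlen) (by simpa [reachProb, mul_assoc] using hpos)
    simp only [reachProb, ← mul_assoc] at hpm
    rw [hpm, hp, div_mul_div_eq_bayes (by positivity)]

/-- In an equilibrium, at a history with a degenerate belief or with positive probability in both
states, the remaining expected utility is what learning the state at once would give. -/
theorem IsEquilibrium.expectedNewsUtility_eq [Fintype M] {s : BayesScope} {μ : ℝ → ℝ}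
    (hμ : IsGainLoss μ) (hsymm : SymmetricAroundZero μ) (hconc : StrictlyConcaveOnGains μ)
    {T : ℕ} {π₀ : ℝ} (hπ₀ : π₀ ∈ Set.Icc (0 : ℝ) 1) {σ : Strategy M} {p : Beliefs M}
    (he : IsEquilibrium s μ T π₀ σ p) (n : ℕ) (h : List M) (hn : n + h.length + 1 = T)
    (hh : (p h = 0 ∨ p h = 1) ∨
      π₀ ∈ Set.Ioo (0 : ℝ) 1 ∧ 0 < reachProb σ .good h ∧ 0 < reachProb σ .bad h) (θ : State) :
    expectedNewsUtility μ p σ θ n h = μ (θ.indicator - p h) := by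
  induction n generalizing h θ with
  | zero => rfl
  | succ n ih =>
    -- It suffices that all messages sent in state `θ` leave the belief unchanged.
    have hfin : (∀ m, 0 < σ h θ m → p (m :: h) = p h ∧
          expectedNewsUtility μ p σ θ n (m :: h) = μ (θ.indicator - p (m :: h))) →
        expectedNewsUtility μ p σ θ (n + 1) h = μ (θ.indicator - p h) := by
      intro hall
      obtain ⟨hnn, hsum⟩ := he.isStrategy h θ
      rw [expectedNewsUtility, ← one_mul (μ (θ.indicator - p h)), ← hsum, sum_mul]
      refine sum_congr rfl fun m _ => ?_
      rcases (hnn m).eq_or_lt with h0 | hpos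
      · simp [← h0]
      · obtain ⟨h1, h2⟩ := hall m hpos
        rw [h2, h1, sub_self, hμ.map_zero, zero_add]
    rcases hh with hdeg | ⟨hπ, hG, hBd⟩
    · refine hfin fun m _ => ?_
      have hpm := he.degenerate h (m :: h) (List.suffix_cons m h) (by simp; omega) hdeg
      exact ⟨hpm, ih (m :: h) (by simp; omega) (.inl (by rwa [hpm])) θ⟩
    · obtain ⟨⟨hp0, hp1⟩, hupd⟩ :=
        (he.bayes.onPath he.isStrategy hπ₀).update he.isStrategy hπ hG hBd (by omega)
      have hg0 := (he.isStrategy h .good).1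
      have hb0 := (he.isStrategy h .bad).1
      have hq1 : 0 < 1 - p h := by linarith
      have hcont : ∀ m, 0 < σ h .good m ∨ 0 < σ h .bad m → ∀ ϑ : State,
          expectedNewsUtility μ p σ ϑ n (m :: h) = μ (ϑ.indicator - p (m :: h)) := by
        intro m hm ϑ
        refine ih (m :: h) (by simp; omega) ?_ ϑ
        have hu := hupd m hm
        rcases (hg0 m).eq_or_lt with hg | hg
        · exact .inl (.inl (by simp [hu, ← hg]))
        · rcases (hb0 m).eq_or_lt with hb | hb
          · refine .inl (.inr ?_)
            rw [hu, ← hb, mul_zero, add_zero, div_self (by positivity)]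
          · exact .inr ⟨hπ, mul_pos hG hg, mul_pos hBd hb⟩
      have hsum : ∑ m, σ h .good m = ∑ m, σ h .bad m := by
        rw [(he.isStrategy h .good).2, (he.isStrategy h .bad).2]
      -- A message `m` sent more in the good state would raise the belief, and would come with a
      -- message `m'` sent more in the bad state; but there `m` is better than `m'`.
      have hno : ∀ m, σ h .good m ≤ σ h .bad m := by
        by_contra! hcon
        obtain ⟨m, hm⟩ := hcon
        obtain ⟨m', hm'⟩ : ∃ m', σ h .good m' < σ h .bad m' := by
          by_contra! hcon
          exact (sum_lt_sum (fun i _ => hcon i) ⟨m, mem_univ m, hm⟩).ne' hsum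
        have hmg : 0 < σ h .good m := (hb0 m).trans_lt hm
        have hmb : 0 < σ h .bad m' := (hg0 m').trans_lt hm'
        have h1 := he.message_le (by omega) .bad m
        rw [← he.message_eq (by omega) .bad hmb, hcont m (.inl hmg), hcont m' (.inr hmb)] at h1
        simp only [State.indicator] at h1
        have hup : p h < p (m :: h) := by
          have hd : 0 < p h * σ h .good m + (1 - p h) * σ h .bad m :=
            add_pos_of_pos_of_nonneg (mul_pos hp0 hmg) (mul_nonneg hq1.le (hb0 m))
          rw [hupd m (.inl hmg), lt_div_iff₀ hd]
          nlinarith [mul_pos (mul_pos hp0 hq1) (sub_pos.2 hm)]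
        have hdown : p (m' :: h) < p h := by
          have hd : 0 < p h * σ h .good m' + (1 - p h) * σ h .bad m' :=
            add_pos_of_nonneg_of_pos (mul_nonneg hp0.le (hg0 m')) (mul_pos hq1 hmb)
          rw [hupd m' (.inr hmb), div_lt_iff₀ hd]
          nlinarith [mul_pos (mul_pos hp0 hq1) (sub_pos.2 hm')]
        have h2 := hμ.lt_false_hope hsymm hconc hp0 hup (he.belief_mem _).2
        have h3 := hμ.loss_le hsymm hconc (he.belief_mem _).1 hdown hp1.le
        linarith
      have heq : ∀ m, σ h .good m = σ h .bad m := fun m =>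
        (sum_eq_sum_iff_of_le fun i _ => hno i).1 hsum m (mem_univ m)
      refine hfin fun m hm => ?_
      have hmb : 0 < σ h .bad m := by
        cases θ
        · rwa [← heq m]
        · exact hm
      refine ⟨?_, hcont m (.inr hmb) θ⟩
      rw [hupd m (.inr hmb), heq m, ← add_mul, add_sub_cancel, one_mul,
        mul_div_cancel_right₀ _ hmb.ne']

/-! ### The babbling equilibrium -/

theorem expectedNewsUtility_const [Fintype M] {μ : ℝ → ℝ} (hμ : IsGainLoss μ) (π₀ : ℝ)
    {σ : Strategy M} (hσ : IsStrategy σ) (θ : State) (n : ℕ) (h : List M) :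
    expectedNewsUtility μ (fun _ => π₀) σ θ n h = μ (θ.indicator - π₀) := by
  induction n generalizing h with
  | zero => rfl
  | succ n ih =>
    simp only [expectedNewsUtility, ih, sub_self, hμ.map_zero, zero_add]
    rw [← sum_mul, (hσ h θ).2, one_mul]

theorem isEquilibrium_babbling [Fintype M] [Nonempty M] {μ : ℝ → ℝ} (hμ : IsGainLoss μ) (T : ℕ)
    {π₀ : ℝ} (hπ₀ : π₀ ∈ Set.Icc (0 : ℝ) 1) (s : BayesScope) :
    IsEquilibrium s μ T π₀ (fun _ _ (_ : M) => (Fintype.card M : ℝ)⁻¹) (fun _ => π₀) := by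
  have hσ : IsStrategy (fun _ _ (_ : M) => (Fintype.card M : ℝ)⁻¹) :=
    fun _ _ => ⟨fun _ => by positivity, by simp⟩
  have hB : BayesConsistent T π₀ (fun _ _ (_ : M) => (Fintype.card M : ℝ)⁻¹) (fun _ => π₀)
      .everyHistory := by
    refine ⟨rfl, fun h m _ _ => ?_⟩
    have hc : (Fintype.card M : ℝ)⁻¹ ≠ 0 := by simp
    rw [← add_mul, add_sub_cancel, one_mul, mul_div_cancel_right₀ _ hc]
  refine ⟨hσ, fun _ => hπ₀, fun h θ _ τ hτ => ?_, ?_, fun _ _ _ _ _ => rfl⟩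
  · rw [expectedNewsUtility_const hμ π₀ hτ, expectedNewsUtility_const hμ π₀ hσ]
  · cases s with
    | onPath => exact hB.onPath hσ hπ₀
    | everyHistory => exact hB

end NewsUtility

open NewsUtility in
theorem proposition9 (μ : ℝ → ℝ) (hμ : NewsUtility.IsGainLoss μ)
    (hsymm : NewsUtility.SymmetricAroundZero μ)
    (hconc : NewsUtility.StrictlyConcaveOnGains μ)
    (M : Type*) [Fintype M] [Nonempty M] (T : ℕ) (hT : 2 ≤ T)
    (π₀ : ℝ) (hπ₀ : π₀ ∈ Set.Icc (0 : ℝ) 1) (s : NewsUtility.BayesScope) :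
    NewsUtility.equilibriumPayoffs s μ M T π₀ = {NewsUtility.babblingPayoff μ π₀} := by
  refine Set.Subset.antisymm ?_ (Set.singleton_subset_iff.2 ?_)
  · rintro v ⟨σ, p, he, rfl⟩
    have hp : p [] = π₀ := by
      have h := he.bayes.onPath he.isStrategy hπ₀ [] (by simp; omega) (by simp [reachProb])
      simpa [reachProb] using h
    have hval : ∀ θ : State, expectedNewsUtility μ p σ θ (T - 1) [] = μ (θ.indicator - π₀) := by
      intro θ
      rw [← hp]
      refine he.expectedNewsUtility_eq hμ hsymm hconc hπ₀ _ _ (by simp; omega) ?_ θ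
      rcases hπ₀.1.eq_or_lt with h0 | h0
      · exact .inl (.inl (hp.trans h0.symm))
      rcases hπ₀.2.eq_or_lt with h1 | h1
      · exact .inl (.inr (hp.trans h1))
      exact .inr ⟨⟨h0, h1⟩, by simp [reachProb], by simp [reachProb]⟩
    simp [hval, babblingPayoff, State.indicator]
  · have he := isEquilibrium_babbling (M := M) hμ T hπ₀ s
    refine ⟨_, _, he, ?_⟩
    simp [expectedNewsUtility_const hμ π₀ he.isStrategy, babblingPayoff, State.indicator]
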